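/- Let $R$ be a commutative ring with unit, $X$ a topological space and $k\in\mathbb{N}_0$. Let $\mathbf{Mod}_R$ be the category of $R$-modules and $\mathbf{grMod}_{R[t]}$ the category of $\mathbb{N}_0$-graded modules over $R[t]$ (graded by degree) with degree-preserving $R[t]$-linear maps. Let $\eta\colon\mathbf{Fun}(\mathbb{N}_0,\mathbf{Mod}_R)\to\mathbf{grMod}_{R[t]}$ send a diagram $D_0\to D_1\to\cdots$ to $\bigoplus_{n}D_n$ with $t$ acting by the maps $D_n\to D_{n+1}$, and let $\epsilon\colon\mathbf{grMod}_{R[t]}\to\mathbf{Fun}(\mathbb{N}_0,\mathbf{Mod}_R)$ send $M=\bigoplus_n M_n$ to $M_0\xrightarrow{t}M_1\xrightarrow{t}\cdots$. For $\mathbf{M}\in\{\mathbf{Mod}_R,\mathbf{grMod}_{R[t]}\}$ let $\mathbf{Shv}(X,\mathbf{M})$ be the category of sheaves on $X$ with values in $\mathbf{M}$, and let $H^k(X,-)\colon\mathbf{Shv}(X,\mathbf{M})\to\mathbf{M}$ be the $k$-th right derived functor of the global section functor. Let $$\mathcal{C}\colon\mathbf{Fun}(\mathbb{N}_0,\mathbf{Shv}(X,\mathbf{Mod}_R))\to\mathbf{Shv}(X,\mathbf{grMod}_{R[t]}),\qquad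 \mathcal{C}(\vec{\mathcal{F}})(U)=\eta\big(\mathcal{F}_0(U)\to\mathcal{F}_1(U)\to\cdots\big),$$ $$\mathcal{E}\colon\mathbf{Shv}(X,\mathbf{grMod}_{R[t]})\to\mathbf{Fun}(\mathbb{N}_0,\mathbf{Shv}(X,\mathbf{Mod}_R)),\qquad \mathcal{E}(M)_n(U)=\epsilon(M(U))_n=M_n(U),$$ with the transition maps of $\mathcal{E}(M)$ given by multiplication by $t$, and let $\underline{H}^k(X,-)\colon\mathbf{Fun}(\mathbb{N}_0,\mathbf{Shv}(X,\mathbf{Mod}_R))\to\mathbf{Fun}(\mathbb{N}_0,\mathbf{Mod}_R)$ be post-composition with $H^k(X,-)$. Then there are natural isomorphisms $$\underline{H}^k(X,-)\circ\mathcal{E}\cong\epsilon\circ H^k(X,-)\qquad\text{and}\qquad \eta\circ\underline{H}^k(X,-)\cong H^k(X,-)\circ\mathcal{C}.$$ Hence $\underline{H}^k(X,\vec{\mathcal{F}})\cong\epsilon\big(H^k(X,\mathcal{C}(\vec{\mathcal{F}}))\big)$, naturally in $\vec{\mathcal{F}}\in\mathbf{Fun}(\mathbb{N}_0,\mathbf{Shv}(X,\mathbf{Mod}_R))$.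 -/

import Mathlib

universe u

open CategoryTheory CategoryTheory.Limits TopologicalSpace Opposite Polynomial

noncomputable section

namespace PersistentSheaf

/-! ### Graded `R[t]`-modules -/

/-- An `ℕ`-graded module over the polynomial ring `R[t]`, which is graded by degree: an
`R[t]`-module that is the internal direct sum of `R`-submodules `deg n`, `n ∈ ℕ`, with
`(a * t ^ i) • deg j ⊆ deg (i + j)`. The `R`-module structure is the restriction of the
`R[t]`-module structure along `R → R[t]`. -/
structure GrMod (R : Type u) [CommRing R] : Type (u + 1) where
  carrier : Type u
  [addCommGroup : AddCommGroup carrier]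
  [moduleBase : Module R carrier]
  [module : Module R[X] carrier]
  [isScalarTower : IsScalarTower R R[X] carrier]
  /-- the homogeneous part of degree `n` -/
  deg : ℕ → Submodule R carrier
  isInternal : DirectSum.IsInternal deg
  monomial_smul_mem : ∀ (i j : ℕ) (a : R) (x : carrier), x ∈ deg j →
    (monomial i a : R[X]) • x ∈ deg (i + j)

namespace GrMod

variable {R : Type u} [CommRing R]

instance : CoeSort (GrMod R) (Type u) := ⟨GrMod.carrier⟩

instance (M : GrMod R) : AddCommGroup M := M.addCommGroup
instance (M : GrMod R) : Module R M := M.moduleBase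
instance (M : GrMod R) : Module R[X] M := M.module
instance (M : GrMod R) : IsScalarTower R R[X] M := M.isScalarTower

/-- The additive group of graded homomorphisms: the `R[t]`-linear maps which preserve degrees. -/
def homs (M N : GrMod R) : AddSubgroup (M →ₗ[R[X]] N) where
  carrier := {f | ∀ (n : ℕ) (x : M), x ∈ M.deg n → f x ∈ N.deg n}
  zero_mem' _ _ _ := Submodule.zero_mem _
  add_mem' hf hg n x hx := Submodule.add_mem _ (hf n x hx) (hg n x hx)
  neg_mem' hf n x hx := Submodule.neg_mem _ (hf n x hx)

/-- The category of graded `R[t]`-modules and graded homomorphisms. -/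
instance : Category.{u} (GrMod R) where
  Hom M N := homs M N
  id M := ⟨LinearMap.id, fun _ _ hx => hx⟩
  comp f g := ⟨g.1 ∘ₗ f.1, fun n x hx => g.2 n _ (f.2 n x hx)⟩

/-- The `R[t]`-linear map underlying a morphism. -/
def toLin {M N : GrMod R} (f : M ⟶ N) : M →ₗ[R[X]] N := f.1

/-- Constructor for morphisms. -/
def ofLin {M N : GrMod R} (f : M →ₗ[R[X]] N) (hf : ∀ (n : ℕ) (x : M), x ∈ M.deg n → f x ∈ N.deg n) :
    M ⟶ N := ⟨f, hf⟩

theorem map_mem {M N : GrMod R} (f : M ⟶ N) {n : ℕ} {x : M} (hx : x ∈ M.deg n) :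
    toLin f x ∈ N.deg n := f.2 n x hx

@[ext] theorem hom_ext {M N : GrMod R} {f g : M ⟶ N} (h : ∀ x, toLin f x = toLin g x) : f = g :=
  Subtype.ext (LinearMap.ext h)

@[simp] theorem toLin_ofLin {M N : GrMod R} (f : M →ₗ[R[X]] N) (hf) (x : M) :
    toLin (ofLin (N := N) f hf) x = f x := rfl
@[simp] theorem toLin_id (M : GrMod R) (x : M) : toLin (𝟙 M) x = x := rfl
@[simp] theorem toLin_comp {M N P : GrMod R} (f : M ⟶ N) (g : N ⟶ P) (x : M) :
    toLin (f ≫ g) x = toLin g (toLin f x) := rfl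

/-- Two morphisms that agree on homogeneous elements are equal. -/
theorem hom_ext_deg {M N : GrMod R} {f g : M ⟶ N}
    (h : ∀ n, ∀ x ∈ M.deg n, toLin f x = toLin g x) : f = g := by
  ext x
  have hx : x ∈ ⨆ n, M.deg n := by
    rw [M.isInternal.submodule_iSup_eq_top]; trivial
  induction hx using Submodule.iSup_induction' with
  | mem i x hx => exact h i x hx
  | zero => simp
  | add x y _ _ hx hy => simp [hx, hy]

instance : Preadditive (GrMod R) where
  homGroup M N := inferInstanceAs (AddCommGroup (homs M N))
  add_comp M N P f g h := by
    ext x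
    exact map_add (toLin h) (toLin f x) (toLin g x)
  comp_add M N P f g h := by
    ext x
    rfl

theorem X_smul_mem (M : GrMod R) {n : ℕ} {x : M} (hx : x ∈ M.deg n) :
    (X : R[X]) • x ∈ M.deg (n + 1) := by
  have := M.monomial_smul_mem 1 n 1 x hx
  rwa [monomial_one_one_eq_X, add_comm] at this

/-- Multiplication by `t`, as a map from degree `n` to degree `n + 1`. -/
def tMul (M : GrMod R) (n : ℕ) : M.deg n →ₗ[R] M.deg (n + 1) where
  toFun x := ⟨(X : R[X]) • (x : M), M.X_smul_mem x.2⟩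
  map_add' _ _ := Subtype.ext (smul_add _ _ _)
  map_smul' _ _ := Subtype.ext (smul_comm _ _ _)

end GrMod

open GrMod

variable (R : Type u) [CommRing R]

/-! ### Persistence modules and graded modules -/

/-- The persistence module `M₀ → M₁ → M₂ → ⋯` of a graded module, with transition maps given by
multiplication by `t`. -/
def epsilonObj {R : Type u} [CommRing R] (M : GrMod R) : ℕ ⥤ ModuleCat.{u} R :=
  Functor.ofSequence (X := fun n => ModuleCat.of R (M.deg n)) fun n => ModuleCat.ofHom (M.tMul n)

/-- The functor `ε` from graded `R[t]`-modules to persistence modules over `ℕ`. -/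
def epsilon : GrMod R ⥤ (ℕ ⥤ ModuleCat.{u} R) where
  obj M := epsilonObj M
  map {M N} f := NatTrans.ofSequence
    (fun n => ModuleCat.ofHom
      (((toLin f).restrictScalars R).restrict (p := M.deg n) (q := N.deg n)
        fun _ hx => map_mem f hx))
    (fun n => by
      simp only [epsilonObj, Functor.ofSequence_map_homOfLE_succ]
      ext x
      exact Subtype.ext (map_smul (toLin f) (X : R[X]) (Subtype.val (p := (· ∈ M.deg n)) x)))
  map_id M := by ext n x; rfl
  map_comp f g := by ext n x; rfl

variable {R} in
/-- The endomorphism of `⨁ n, Dₙ` given on the `n`-th summand by `Dₙ → Dₙ₊₁`. -/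
def shift (D : ℕ ⥤ ModuleCat.{u} R) : Module.End R (DirectSum ℕ fun n => D.obj n) :=
  DirectSum.toModule R ℕ _ fun n =>
    DirectSum.lof R ℕ (fun n => D.obj n) (n + 1) ∘ₗ (D.map (homOfLE (Nat.le_add_right n 1))).hom

variable {R} in
@[simp] theorem shift_lof (D : ℕ ⥤ ModuleCat.{u} R) (n : ℕ) (x : D.obj n) :
    shift D (DirectSum.lof R ℕ (fun n => D.obj n) n x) =
      DirectSum.lof R ℕ (fun n => D.obj n) (n + 1)
        ((D.map (homOfLE (Nat.le_add_right n 1))).hom x) := by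
  simp [shift]

variable {R} in
theorem shift_pow_mem (D : ℕ ⥤ ModuleCat.{u} R) (i j : ℕ) (x : D.obj j) :
    (shift D ^ i) (DirectSum.lof R ℕ (fun n => D.obj n) j x) ∈
      LinearMap.range (DirectSum.lof R ℕ (fun n => D.obj n) (i + j)) := by
  induction i with
  | zero => rw [Nat.zero_add]; exact ⟨x, rfl⟩
  | succ i ih =>
    obtain ⟨y, hy⟩ := ih
    rw [pow_succ', Module.End.mul_apply, ← hy, shift_lof, Nat.add_right_comm]
    exact ⟨_, rfl⟩

variable {R} in
theorem isInternal_range_lof (D : ℕ → Type u) [∀ n, AddCommGroup (D n)] [∀ n, Module R (D n)] :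
    DirectSum.IsInternal fun n => LinearMap.range (DirectSum.lof R ℕ D n) := by
  let e : (DirectSum ℕ D) ≃ₗ[R]
      DirectSum ℕ fun n => LinearMap.range (DirectSum.lof R ℕ D n) :=
    DFinsupp.mapRange.linearEquiv fun n => LinearEquiv.ofInjective _ (DirectSum.of_injective n)
  have h : DirectSum.coeLinearMap (fun n => LinearMap.range (DirectSum.lof R ℕ D n)) ∘ₗ
      e.toLinearMap = LinearMap.id := by
    ext n x : 2
    have : e (DirectSum.lof R ℕ D n x) = DirectSum.lof R ℕ
        (fun n => LinearMap.range (DirectSum.lof R ℕ D n)) n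
        ⟨DirectSum.lof R ℕ D n x, x, rfl⟩ :=
      DFinsupp.mapRange_single (hf := fun i => map_zero _)
    simp [this]
  have hb : Function.Bijective (DirectSum.coeLinearMap
      (fun n => LinearMap.range (DirectSum.lof R ℕ D n)) ∘ e) := by
    have : (DirectSum.coeLinearMap (fun n => LinearMap.range (DirectSum.lof R ℕ D n)) ∘ e) = id :=
      funext fun x => LinearMap.congr_fun h x
    rw [this]; exact Function.bijective_id
  exact (Function.Bijective.of_comp_iff _ e.bijective).1 hb

variable {R} in
/-- The graded module `⨁ n, Dₙ` of a persistence module `D`, where `t` acts by `Dₙ → Dₙ₊₁`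
and `Dₙ` is the part of degree `n`. -/
def etaObj (D : ℕ ⥤ ModuleCat.{u} R) : GrMod R :=
  letI : Module R[X] (DirectSum ℕ fun n => D.obj n) :=
    Module.compHom _ (aeval (shift D)).toRingHom
  have smul_def (p : R[X]) (x : DirectSum ℕ fun n => D.obj n) : p • x = aeval (shift D) p x := rfl
  { carrier := DirectSum ℕ fun n => D.obj n
    isScalarTower := ⟨fun r p x => by simp [smul_def]⟩
    deg := fun n => LinearMap.range (DirectSum.lof R ℕ (fun n => D.obj n) n)
    isInternal := isInternal_range_lof fun n => D.obj n
    monomial_smul_mem := by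
      rintro i j a _ ⟨x, rfl⟩
      rw [smul_def, aeval_monomial, Module.End.mul_apply, Module.algebraMap_end_apply]
      exact Submodule.smul_mem _ _ (shift_pow_mem D i j x) }

variable {R} in
/-- The inclusion of the `n`-th summand. -/
def etaι (D : ℕ ⥤ ModuleCat.{u} R) (n : ℕ) : D.obj n →ₗ[R] etaObj D :=
  DirectSum.lof R ℕ (fun n => D.obj n) n

variable {R} in
theorem X_smul_eta (D : ℕ ⥤ ModuleCat.{u} R) (x : etaObj D) : (X : R[X]) • x = shift D x := by
  change aeval (shift D) X x = _
  simp

variable {R} in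
theorem X_smul_etaι (D : ℕ ⥤ ModuleCat.{u} R) (n : ℕ) (x : D.obj n) :
    (X : R[X]) • etaι D n x =
      etaι D (n + 1) ((D.map (homOfLE (Nat.le_add_right n 1))).hom x) := by
  rw [X_smul_eta]; exact shift_lof D n x

variable {R} in
/-- An `R`-linear map between `R[t]`-modules that commutes with `t` is `R[t]`-linear. -/
def linOfComm {M N : GrMod R} (f : M →ₗ[R] N) (h : ∀ x, f ((X : R[X]) • x) = (X : R[X]) • f x) :
    M →ₗ[R[X]] N where
  toFun := f
  map_add' := map_add f
  map_smul' p x := by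
    induction p using Polynomial.induction_on' generalizing x with
    | add p q hp hq => simp only [add_smul, map_add, RingHom.id_apply] at *; rw [hp, hq]
    | monomial n a =>
      induction n generalizing x with
      | zero =>
        have (P : GrMod R) (y : P) : (monomial 0 a : R[X]) • y = a • y := by
          rw [monomial_zero_left, ← Polynomial.algebraMap_eq, algebraMap_smul]
        simp only [this, map_smul, RingHom.id_apply]
      | succ n ih =>
        rw [← monomial_mul_X, RingHom.id_apply, mul_smul, mul_smul, ih, h, RingHom.id_apply]

variable {R} in
/-- Morphisms out of `⨁ n, Dₙ`. -/
def etaDesc {D : ℕ ⥤ ModuleCat.{u} R} {M : GrMod R} (f : ∀ n, D.obj n →ₗ[R] M)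
    (hdeg : ∀ n x, f n x ∈ M.deg n)
    (h : ∀ n x, f (n + 1) ((D.map (homOfLE (Nat.le_add_right n 1))).hom x) = (X : R[X]) • f n x) :
    etaObj D ⟶ M :=
  ofLin (linOfComm (M := etaObj D) (DirectSum.toModule R ℕ M f) (by
    intro x
    have : (DirectSum.toModule R ℕ M f) ∘ₗ shift D =
        (Module.toModuleEnd R (S := R[X]) M X) ∘ₗ (DirectSum.toModule R ℕ M f) := by
      ext n x
      simp [h]
    rw [X_smul_eta]
    exact LinearMap.congr_fun this x)) (by
    rintro n _ ⟨x, rfl⟩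
    have : DirectSum.toModule R ℕ M f (DirectSum.lof R ℕ (fun n => D.obj n) n x) = f n x := by simp
    exact this ▸ hdeg n x)

variable {R} in
@[simp] theorem etaDesc_ι {D : ℕ ⥤ ModuleCat.{u} R} {M : GrMod R} (f : ∀ n, D.obj n →ₗ[R] M)
    (hdeg) (h) (n : ℕ) (x : D.obj n) :
    toLin (etaDesc f hdeg h) (etaι D n x) = f n x :=
  DirectSum.toModule_lof (φ := f) R n x

variable {R} in
theorem eta_hom_ext {D : ℕ ⥤ ModuleCat.{u} R} {M : GrMod R} {f g : etaObj D ⟶ M}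
    (h : ∀ n (x : D.obj n), toLin f (etaι D n x) = toLin g (etaι D n x)) : f = g := by
  apply hom_ext_deg
  rintro n _ ⟨x, rfl⟩
  exact h n x

variable {R} in
theorem etaι_mem (D : ℕ ⥤ ModuleCat.{u} R) (n : ℕ) (x : D.obj n) :
    etaι D n x ∈ (etaObj D).deg n := ⟨x, rfl⟩

variable {R} in
/-- The action of `η` on morphisms: the direct sum of the maps `φₙ`. -/
def etaMap {D D' : ℕ ⥤ ModuleCat.{u} R} (φ : D ⟶ D') : etaObj D ⟶ etaObj D' :=
  etaDesc (fun n => etaι D' n ∘ₗ (φ.app n).hom) (fun n x => etaι_mem D' n _) (fun n x => by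
    have := ConcreteCategory.congr_hom (φ.naturality (homOfLE (Nat.le_add_right n 1))) x
    simp only [LinearMap.comp_apply, X_smul_etaι]
    exact congrArg (etaι D' (n + 1)) this)

variable {R} in
@[simp] theorem toLin_etaMap {D D' : ℕ ⥤ ModuleCat.{u} R} (φ : D ⟶ D') (n : ℕ) (x : D.obj n) :
    toLin (etaMap φ) (etaι D n x) = etaι D' n ((φ.app n).hom x) := by
  simp [etaMap]

/-- The functor `η` from persistence modules over `ℕ` to graded `R[t]`-modules. -/
def eta : (ℕ ⥤ ModuleCat.{u} R) ⥤ GrMod R where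
  obj D := etaObj D
  map φ := etaMap φ
  map_id D := eta_hom_ext fun n x => by simp
  map_comp φ ψ := eta_hom_ext fun n x => by simp

variable {R} in
/-- The canonical morphism `⨁ n, Mₙ → M`. -/
def etaEpsilonHom (M : GrMod R) : etaObj (epsilonObj M) ⟶ M :=
  etaDesc (D := epsilonObj M) (fun n => (M.deg n).subtype) (fun _ x => Subtype.property x)
    (fun n x => by
      simp only [epsilonObj, Functor.ofSequence_map_homOfLE_succ]
      rfl)

variable {R} in
theorem etaEpsilonHom_ι (M : GrMod R) (n : ℕ) (x : M.deg n) :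
    toLin (etaEpsilonHom M) (etaι (epsilonObj M) n x) = (x : M) :=
  etaDesc_ι (D := epsilonObj M) (fun n => (M.deg n).subtype) _ _ n x

variable {R} in
/-- The inverse of the canonical morphism `⨁ n, Mₙ → M`. -/
def etaEpsilonInv (M : GrMod R) : M ⟶ etaObj (epsilonObj M) :=
  let e : etaObj (epsilonObj M) ≃ₗ[R] M :=
    LinearEquiv.ofBijective (DirectSum.coeLinearMap M.deg) M.isInternal
  have he (x : etaObj (epsilonObj M)) : e x = toLin (etaEpsilonHom M) x := rfl
  ofLin (linOfComm e.symm.toLinearMap fun x => by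
      apply e.injective
      simp only [LinearEquiv.coe_coe, LinearEquiv.apply_symm_apply]
      rw [he, map_smul, ← he, LinearEquiv.apply_symm_apply]) (by
    intro n x hx
    refine ⟨(⟨x, hx⟩ : M.deg n), ?_⟩
    apply e.injective
    refine Eq.trans ?_ (e.apply_symm_apply x).symm
    exact DirectSum.coeLinearMap_lof M.deg n ⟨x, hx⟩)

/-- The natural isomorphism `η ∘ ε ≅ id`. -/
def etaEpsilonIso : epsilon R ⋙ eta R ≅ 𝟭 (GrMod R) :=
  NatIso.ofComponents (fun M =>
    { hom := etaEpsilonHom M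
      inv := etaEpsilonInv M
      hom_inv_id := by
        ext x
        exact (LinearEquiv.ofBijective (DirectSum.coeLinearMap M.deg)
          M.isInternal).symm_apply_apply x
      inv_hom_id := by
        ext x
        exact (LinearEquiv.ofBijective (DirectSum.coeLinearMap M.deg)
          M.isInternal).apply_symm_apply x }) (fun {M N} f => by
      apply eta_hom_ext (D := epsilonObj M)
      intro n x
      exact (congrArg (toLin (etaEpsilonHom N)) (toLin_etaMap ((epsilon R).map f) n x)).trans
        ((etaEpsilonHom_ι N n _).trans (congrArg (toLin f) (etaEpsilonHom_ι M n x)).symm))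

variable {R} in
/-- The canonical morphism `D → ε (η D)`. -/
def epsilonEtaHom (D : ℕ ⥤ ModuleCat.{u} R) : D ⟶ epsilonObj (etaObj D) :=
  NatTrans.ofSequence
    (fun n => ModuleCat.ofHom ((etaι D n).codRestrict ((etaObj D).deg n) (etaι_mem D n)))
    (fun n => by
      simp only [epsilonObj, Functor.ofSequence_map_homOfLE_succ]
      ext x
      exact Subtype.ext (X_smul_etaι D n x).symm)

variable {R} in
theorem isIso_epsilonEtaHom (D : ℕ ⥤ ModuleCat.{u} R) : IsIso (epsilonEtaHom D) := by
  have (n : ℕ) : IsIso ((epsilonEtaHom D).app n) := by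
    apply (ConcreteCategory.isIso_iff_bijective _).2
    constructor
    · intro x y h
      exact DirectSum.of_injective (β := fun n => D.obj n) n (congrArg Subtype.val h)
    · rintro ⟨_, x, rfl⟩
      exact ⟨x, rfl⟩
  exact NatIso.isIso_of_isIso_app _

/-- The natural isomorphism `id ≅ ε ∘ η`. -/
def epsilonEtaIso : 𝟭 (ℕ ⥤ ModuleCat.{u} R) ≅ eta R ⋙ epsilon R :=
  NatIso.ofComponents (fun D => @asIso _ _ _ _ (epsilonEtaHom D) (isIso_epsilonEtaHom D)) (fun {D D'} φ => by
    ext n x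
    exact Subtype.ext (toLin_etaMap φ n x).symm)

/-- The equivalence between persistence modules and graded `R[t]`-modules. -/
def etaEquivalence : (ℕ ⥤ ModuleCat.{u} R) ≌ GrMod R :=
  CategoryTheory.Equivalence.mk (eta R) (epsilon R) (epsilonEtaIso R) (etaEpsilonIso R)

instance : (eta R).IsEquivalence := (etaEquivalence R).isEquivalence_functor
instance : (epsilon R).IsEquivalence := (etaEquivalence R).isEquivalence_inverse

instance : (epsilon R).Additive where
  map_add := by intros; ext n x; rfl

/-! ### `GrMod R` is a Grothendieck abelian category -/

instance : HasFiniteLimits (GrMod R) :=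
  ⟨fun _ _ _ => Adjunction.hasLimitsOfShape_of_equivalence (epsilon R)⟩

instance : HasFiniteProducts (GrMod R) := inferInstance

instance : Abelian (GrMod R) := abelianOfEquivalence (epsilon R)

instance : HasSeparator (ℕ ⥤ ModuleCat.{u} R) :=
  HasSeparator.of_equivalence (opOpEquivalence ℕ).congrLeft

instance : IsGrothendieckAbelian.{u} (ℕ ⥤ ModuleCat.{u} R) where
  ab5OfSize := ⟨fun _ _ _ => inferInstance⟩

instance : IsGrothendieckAbelian.{u} (GrMod R) :=
  IsGrothendieckAbelian.of_equivalence (etaEquivalence R)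

/-! ### Sheaves -/

/-- The category of presheaves on `X` with values in `M`. -/
abbrev PShv (X : TopCat.{u}) (M : Type*) [Category* M] := (Opens X)ᵒᵖ ⥤ M

/-- The category of sheaves on `X` with values in `M`. -/
abbrev Shv (X : TopCat.{u}) (M : Type*) [Category* M] := Sheaf (Opens.grothendieckTopology X) M

/-- The functor `Fun(ℕ, A) ⥤ Fun(ℕ, B)` given by post-composition with `F : A ⥤ B`. -/
abbrev levelwise {A B : Type*} [Category* A] [Category* B] (F : A ⥤ B) : (ℕ ⥤ A) ⥤ (ℕ ⥤ B) :=
  (Functor.whiskeringRight ℕ A B).obj F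

variable (X : TopCat.{u})

/-- From diagrams of presheaves of modules to presheaves of graded modules: for every `U`, apply
`η` to the persistence module `F₀(U) → F₁(U) → ⋯`. -/
def presheafC : (ℕ ⥤ PShv X (ModuleCat.{u} R)) ⥤ PShv X (GrMod R) :=
  flipFunctor _ _ _ ⋙ (Functor.whiskeringRight _ _ _).obj (eta R)

/-- From presheaves of graded modules to diagrams of presheaves of modules: the `n`-th presheaf is
`U ↦ M(U)ₙ`, and the transition maps are multiplication by `t`. -/
def presheafE : PShv X (GrMod R) ⥤ (ℕ ⥤ PShv X (ModuleCat.{u} R)) :=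
  (Functor.whiskeringRight _ _ _).obj (epsilon R) ⋙ flipFunctor _ _ _

theorem presheafE_isSheaf (M : Shv X (GrMod R)) (n : ℕ) :
    Presheaf.IsSheaf (Opens.grothendieckTopology X) (((presheafE R X).obj M.obj).obj n) := by
  rw [Presheaf.isSheaf_iff_isLimit]
  intro U S hS
  obtain ⟨h⟩ := (Presheaf.isSheaf_iff_isLimit _ _).1 M.property S hS
  exact ⟨isLimitOfPreserves (epsilon R ⋙ (evaluation ℕ _).obj n) h⟩

theorem presheafC_isSheaf (F : ℕ ⥤ Shv X (ModuleCat.{u} R)) :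
    Presheaf.IsSheaf (Opens.grothendieckTopology X)
      ((presheafC R X).obj ((levelwise (sheafToPresheaf _ _)).obj F)) := by
  rw [Presheaf.isSheaf_iff_isLimit]
  intro U S hS
  have h (n : ℕ) := (Presheaf.isSheaf_iff_isLimit _ _).1 (F.obj n).property S hS
  exact ⟨isLimitOfPreserves (eta R)
    (c := ((levelwise (sheafToPresheaf _ _)).obj F).flip.mapCone S.arrows.cocone.op)
    (evaluationJointlyReflectsLimits _ fun n => (h n).some)⟩

/-- The functor `𝒞` from diagrams of sheaves of modules to sheaves of graded modules. -/
def corrC : (ℕ ⥤ Shv X (ModuleCat.{u} R)) ⥤ Shv X (GrMod R) :=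
  ObjectProperty.lift _ (levelwise (sheafToPresheaf _ _) ⋙ presheafC R X) (presheafC_isSheaf R X)

/-- The functor `ℰ` from sheaves of graded modules to diagrams of sheaves of modules. -/
def corrE : Shv X (GrMod R) ⥤ (ℕ ⥤ Shv X (ModuleCat.{u} R)) where
  obj M := ObjectProperty.lift _ ((presheafE R X).obj M.obj) (presheafE_isSheaf R X M)
  map f :=
    { app := fun n => ObjectProperty.homMk (((presheafE R X).map f.hom).app n)
      naturality := fun m n g => by
        ext1
        exact ((presheafE R X).map f.hom).naturality g }

/-- The natural isomorphism `𝒞 ∘ ℰ ≅ id`. -/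
def corrECIso : corrE R X ⋙ corrC R X ≅ 𝟭 (Shv X (GrMod R)) :=
  (fullyFaithfulSheafToPresheaf _ _).whiskeringRight _ |>.preimageIso
    (Functor.isoWhiskerLeft (sheafToPresheaf _ _)
      ((Functor.whiskeringRight (Opens X)ᵒᵖ _ _).mapIso (etaEpsilonIso R)))

/-- The natural isomorphism `id ≅ ℰ ∘ 𝒞`. -/
def corrCEIso : 𝟭 (ℕ ⥤ Shv X (ModuleCat.{u} R)) ≅ corrC R X ⋙ corrE R X :=
  ((fullyFaithfulSheafToPresheaf _ _).whiskeringRight ℕ).whiskeringRight _ |>.preimageIso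
    (Functor.isoWhiskerLeft (levelwise (sheafToPresheaf _ _) ⋙ flipFunctor _ _ _)
      (Functor.isoWhiskerRight ((Functor.whiskeringRight (Opens X)ᵒᵖ _ _).mapIso (epsilonEtaIso R))
        (flipFunctor _ _ _)))

/-- The equivalence between diagrams of sheaves of modules and sheaves of graded modules. -/
def corrEquivalence : (ℕ ⥤ Shv X (ModuleCat.{u} R)) ≌ Shv X (GrMod R) :=
  CategoryTheory.Equivalence.mk (corrC R X) (corrE R X) (corrCEIso R X) (corrECIso R X)

instance : (corrC R X).IsEquivalence := (corrEquivalence R X).isEquivalence_functor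
instance : (corrE R X).IsEquivalence := (corrEquivalence R X).isEquivalence_inverse

/-- The equivalence between diagrams of presheaves of modules and presheaves of graded modules. -/
def presheafEquivalence : (ℕ ⥤ PShv X (ModuleCat.{u} R)) ≌ PShv X (GrMod R) :=
  CategoryTheory.Equivalence.mk (presheafC R X) (presheafE R X)
    (Functor.isoWhiskerLeft (flipFunctor _ _ _)
      (Functor.isoWhiskerRight ((Functor.whiskeringRight (Opens X)ᵒᵖ _ _).mapIso (epsilonEtaIso R))
        (flipFunctor _ _ _)))
    ((Functor.whiskeringRight (Opens X)ᵒᵖ _ _).mapIso (etaEpsilonIso R))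

/-- The adjunction between sheafification of presheaves of graded modules (apply `ℰ`, sheafify
levelwise, and apply `𝒞`) and the inclusion of sheaves into presheaves. -/
def sheafifyAdjunction :
    (presheafEquivalence R X).inverse ⋙
        levelwise (presheafToSheaf (Opens.grothendieckTopology X) (ModuleCat.{u} R)) ⋙
        (corrEquivalence R X).functor ⊣
      sheafToPresheaf (Opens.grothendieckTopology X) (GrMod R) :=
  ((presheafEquivalence R X).symm.toAdjunction.comp
    (((sheafificationAdjunction (Opens.grothendieckTopology X) (ModuleCat.{u} R)).whiskerRight
      ℕ).comp (corrEquivalence R X).toAdjunction)).ofNatIsoRight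
    (Functor.isoWhiskerLeft (sheafToPresheaf (Opens.grothendieckTopology X) (GrMod R))
      ((Functor.whiskeringRight (Opens X)ᵒᵖ _ _).mapIso (etaEpsilonIso R)))

instance : HasSheafify (Opens.grothendieckTopology X) (GrMod R) :=
  have : PreservesFiniteLimits
      (levelwise (presheafToSheaf (Opens.grothendieckTopology X) (ModuleCat.{u} R))) :=
    ⟨fun _ _ _ => inferInstance⟩
  have : PreservesFiniteLimits
      (levelwise (presheafToSheaf (Opens.grothendieckTopology X) (ModuleCat.{u} R)) ⋙
        (corrEquivalence R X).functor) := comp_preservesFiniteLimits _ _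
  have : PreservesFiniteLimits ((presheafEquivalence R X).inverse ⋙
      levelwise (presheafToSheaf (Opens.grothendieckTopology X) (ModuleCat.{u} R)) ⋙
      (corrEquivalence R X).functor) := comp_preservesFiniteLimits _ _
  HasSheafify.mk' _ _ (sheafifyAdjunction R X)

/-! ### Sheaf cohomology -/

section

variable (M : Type*) [Category* M]

/-- The global section functor `Γ(X, -)`. -/
def globalSections : Shv X M ⥤ M :=
  sheafToPresheaf _ _ ⋙ (evaluation _ _).obj (op ⊤)

variable [Abelian M] [HasSheafify (Opens.grothendieckTopology X) M]

instance : (globalSections X M).Additive where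

end

section

variable (M : Type (u + 1)) [Category.{u} M] [Abelian M] [IsGrothendieckAbelian.{u} M]
  [HasSheafify (Opens.grothendieckTopology X) M]

/-- The `k`-th sheaf cohomology functor `Hᵏ(X, -)`: the `k`-th right derived functor of the global
section functor. -/
def sheafCohomology (k : ℕ) : Shv X M ⥤ M :=
  (globalSections X M).rightDerived k

end

end PersistentSheaf

end

open PersistentSheaf

noncomputable section

/-! ### Evaluation of diagrams and injective objects. -/

namespace CategoryTheory

/-! The functors `eta`, `epsilon` and `corrC`, `corrE` form two pairs of mutually inverse
equivalences, so all three claims reduce to the one about `corrC` and `eta`. Global sections commute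
with these two functors, and equivalences are exact and preserve injectives. Hence
`rightDerivedIsoOfComp` identifies the cohomology of `corrC` of a diagram with `eta` of the derived
functors of levelwise global sections.

It remains to see that these derived functors are computed levelwise
(`whiskeringRightRightDerivedIso`). Evaluation at `n` is exact and preserves injectives, so an
injective resolution of a diagram evaluates to an injective resolution of each of its terms. The
transition maps of the resolution lift those of the diagram, which makes the comparison natural in
`n` (`rightDerivedIsoOfComp_natTrans`). -/

/-- Evaluation at an object preserves injective objects when the indexing category has finite
hom-sets: its left adjoint preserves monomorphisms. -/
theorem preservesInjectiveObjects_evaluation {K : Type*} [Category* K] [∀ a b : K, Finite (a ⟶ b)]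
    {A : Type*} [Category* A] [Abelian A] (n : K) :
    ((evaluation K A).obj n).PreservesInjectiveObjects := by
  have : (evaluationLeftAdjoint A n).PreservesMonomorphisms := ⟨fun {a b} f hf => by
    have (m : K) : Mono (((evaluationLeftAdjoint A n).map f).app m) := by
      -- The left adjoint sends `a` to the diagram of coproducts of copies of `a` indexed by `n ⟶
      -- m`. These are finite, hence biproducts, so a coproduct of monomorphisms is again one.
      have e : ((evaluationLeftAdjoint A n).map f).app m =
          Limits.Sigma.map fun _ : n ⟶ m => f := by
        apply Sigma.hom_ext
        intro g
        exact (colimit.ι_desc _ _).trans (colimit.ι_desc _ _).symm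
      rw [e]
      have := Abelian.hasFiniteBiproducts (C := A)
      exact Sigma.map_mono _
    exact NatTrans.mono_of_mono_app _⟩
  exact Functor.preservesInjectiveObjects_of_adjunction_of_preservesMonomorphisms
    (evaluationAdjunctionRight A n)

/-! ### Right derived functors and exact functors. -/

section RightDerived

variable {C C' B B' : Type*} [Category* C] [Category* C'] [Category* B] [Category* B']
  [Abelian C] [Abelian C'] [Abelian B] [Abelian B']

/-- The image of an injective resolution under an exact functor which preserves injective
objects. -/
def InjectiveResolution.map {Z : C} (I : InjectiveResolution Z) (P : C ⥤ C') [P.Additive]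
    [PreservesFiniteLimits P] [PreservesFiniteColimits P] [P.PreservesInjectiveObjects] :
    InjectiveResolution (P.obj Z) where
  cocomplex := (P.mapHomologicalComplex _).obj I.cocomplex
  injective n := inferInstanceAs (Injective (P.obj (I.cocomplex.X n)))
  ι := (HomologicalComplex.singleMapHomologicalComplex P (ComplexShape.up ℕ) 0).inv.app Z ≫
    (P.mapHomologicalComplex _).map I.ι
  quasiIso := by
    have : QuasiIso ((P.mapHomologicalComplex (ComplexShape.up ℕ)).map I.ι) := inferInstance
    exact quasiIso_comp _ _

/-- The comparison of single complexes is an identity in degree zero. Whether a chain map between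
resolutions lifts a given morphism is tested in this degree. -/
theorem InjectiveResolution.map_ι_f_zero {Z : C} (I : InjectiveResolution Z) (P : C ⥤ C')
    [P.Additive] [PreservesFiniteLimits P] [PreservesFiniteColimits P]
    [P.PreservesInjectiveObjects] : (I.map P).ι.f 0 = P.map (I.ι.f 0) := by
  have h : ((HomologicalComplex.singleMapHomologicalComplex P (ComplexShape.up ℕ) 0).inv.app
      Z).f 0 = 𝟙 (P.obj Z) := by
    rw [HomologicalComplex.singleMapHomologicalComplex_inv_app_self]
    simp only [HomologicalComplex.singleObjXSelf, HomologicalComplex.singleObjXIsoOfEq,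
      eqToIso.hom, eqToIso.inv, eqToHom_map, eqToHom_trans]
    rfl
  exact (congrArg (· ≫ P.map (I.ι.f 0)) h).trans (Category.id_comp _)

/-- If `Q` is exact and `P ⋙ F' ≅ F ⋙ Q`, the homology of `F' P K` is the image under `Q` of the
homology of `F K`. -/
def mapHomologyIsoOfComp {P : C ⥤ C'} {F : C ⥤ B} {F' : C' ⥤ B'} {Q : B ⥤ B'} [P.Additive]
    [F.Additive] [F'.Additive] [Q.Additive] [PreservesFiniteLimits Q] [PreservesFiniteColimits Q]
    (e : P ⋙ F' ≅ F ⋙ Q) (K : CochainComplex C ℕ) (k : ℕ) :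
    ((F'.mapHomologicalComplex _).obj ((P.mapHomologicalComplex _).obj K)).homology k ≅
      Q.obj (((F.mapHomologicalComplex _).obj K).homology k) :=
  ShortComplex.homologyMapIso ((K.sc k).mapNatIso e) ≪≫
    (((F.mapHomologicalComplex _).obj K).sc k).mapHomologyIso Q

theorem mapHomologyIsoOfComp_naturality {P : C ⥤ C'} {F : C ⥤ B} {F' : C' ⥤ B'} {Q : B ⥤ B'}
    [P.Additive] [F.Additive] [F'.Additive] [Q.Additive] [PreservesFiniteLimits Q]
    [PreservesFiniteColimits Q] (e : P ⋙ F' ≅ F ⋙ Q) {K L : CochainComplex C ℕ} (φ : K ⟶ L)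
    (k : ℕ) :
    HomologicalComplex.homologyMap
        ((F'.mapHomologicalComplex _).map ((P.mapHomologicalComplex _).map φ)) k ≫
        (mapHomologyIsoOfComp e L k).hom =
      (mapHomologyIsoOfComp e K k).hom ≫
        Q.map (HomologicalComplex.homologyMap ((F.mapHomologicalComplex _).map φ) k) := by
  have h := ShortComplex.mapHomologyIso_hom_naturality
    ((HomologicalComplex.shortComplexFunctor B _ k).map
      ((F.mapHomologicalComplex (ComplexShape.up ℕ)).map φ)) Q
  refine Eq.trans ?_ ((congrArg (ShortComplex.homologyMap ((K.sc k).mapNatTrans e.hom) ≫ ·)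
    h).trans (Category.assoc _ _ _).symm)
  refine (Category.assoc _ _ _).symm.trans (Eq.trans ?_ (Category.assoc _ _ _))
  congr 1
  refine (ShortComplex.homologyMap_comp _ _).symm.trans
    (Eq.trans ?_ (ShortComplex.homologyMap_comp _ _))
  congr 1
  -- Maps of short complexes are compared on the three objects, where the claim is naturality of `e`
  -- at the components of `φ`.
  ext
  · exact e.hom.naturality _
  · exact e.hom.naturality _
  · exact e.hom.naturality _

/-- The hypothesis `h` settles the matter on the terms of `K`. Passing to homology is then
compatible with `β`, since both `Q₁` and `Q₂` are exact. -/
theorem mapHomologyIsoOfComp_natTrans {P₁ P₂ : C ⥤ C'} {F : C ⥤ B} {F' : C' ⥤ B'}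
    {Q₁ Q₂ : B ⥤ B'} [P₁.Additive] [P₂.Additive] [F.Additive] [F'.Additive]
    [Q₁.Additive] [PreservesFiniteLimits Q₁] [PreservesFiniteColimits Q₁]
    [Q₂.Additive] [PreservesFiniteLimits Q₂] [PreservesFiniteColimits Q₂]
    (e₁ : P₁ ⋙ F' ≅ F ⋙ Q₁) (e₂ : P₂ ⋙ F' ≅ F ⋙ Q₂) (α : P₁ ⟶ P₂) (β : Q₁ ⟶ Q₂)
    (h : Functor.whiskerRight α F' ≫ e₂.hom = e₁.hom ≫ Functor.whiskerLeft F β)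
    (K : CochainComplex C ℕ) (k : ℕ) :
    HomologicalComplex.homologyMap ((F'.mapHomologicalComplex _).map
        ((NatTrans.mapHomologicalComplex α _).app K)) k ≫ (mapHomologyIsoOfComp e₂ K k).hom =
      (mapHomologyIsoOfComp e₁ K k).hom ≫
        β.app (((F.mapHomologicalComplex _).obj K).homology k) := by
  have hβ : ((((F.mapHomologicalComplex _).obj K).sc k).mapHomologyIso Q₁).hom ≫
      β.app (((F.mapHomologicalComplex _).obj K).homology k) =
      ShortComplex.homologyMap ((((F.mapHomologicalComplex _).obj K).sc k).mapNatTrans β) ≫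
      ((((F.mapHomologicalComplex _).obj K).sc k).mapHomologyIso Q₂).hom := by
    rw [ShortComplex.homologyMap_mapNatTrans]
    rw [Category.assoc, Category.assoc, Iso.inv_hom_id, Category.comp_id]
    rfl
  refine Eq.trans ?_ ((congrArg (ShortComplex.homologyMap ((K.sc k).mapNatTrans e₁.hom) ≫ ·)
    hβ.symm).trans (Category.assoc _ _ _).symm)
  refine (Category.assoc _ _ _).symm.trans (Eq.trans ?_ (Category.assoc _ _ _))
  congr 1
  refine (ShortComplex.homologyMap_comp _ _).symm.trans
    (Eq.trans ?_ (ShortComplex.homologyMap_comp _ _))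
  congr 1
  ext
  · exact NatTrans.congr_app h _
  · exact NatTrans.congr_app h _
  · exact NatTrans.congr_app h _

section

variable [HasInjectiveResolutions C] [HasInjectiveResolutions C']

/-- Right derived functors commute with exact functors: if `P` and `Q` are exact, `P` preserves
injective objects and `P ⋙ F' ≅ F ⋙ Q`, then `P ⋙ Rᵏ F' ≅ Rᵏ F ⋙ Q`. -/
def rightDerivedIsoOfComp {P : C ⥤ C'} {F : C ⥤ B} {F' : C' ⥤ B'} {Q : B ⥤ B'} [P.Additive]
    [PreservesFiniteLimits P] [PreservesFiniteColimits P] [P.PreservesInjectiveObjects]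
    [F.Additive] [F'.Additive] [Q.Additive] [PreservesFiniteLimits Q] [PreservesFiniteColimits Q]
    (e : P ⋙ F' ≅ F ⋙ Q) (k : ℕ) : P ⋙ F'.rightDerived k ≅ F.rightDerived k ⋙ Q :=
  NatIso.ofComponents (fun Z => ((injectiveResolution Z).map P).isoRightDerivedObj F' k ≪≫
      mapHomologyIsoOfComp e _ k ≪≫ Q.mapIso ((injectiveResolution Z).isoRightDerivedObj F k).symm)
    (fun {Z W} f => by
      -- Since `φ` lifts `f`, its image under `P` lifts `P.map f`, so one chain map computes both
      -- derived functors on morphisms.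
      let φ := InjectiveResolution.desc f (injectiveResolution W) (injectiveResolution Z)
      have comm : (injectiveResolution Z).ι.f 0 ≫ φ.f 0 = f ≫ (injectiveResolution W).ι.f 0 :=
        InjectiveResolution.desc_commutes_zero _ _ _
      have h₁ := ((injectiveResolution Z).map P).isoRightDerivedObj_hom_naturality (P.map f)
        ((injectiveResolution W).map P) ((P.mapHomologicalComplex _).map φ) (by
          rw [InjectiveResolution.map_ι_f_zero, InjectiveResolution.map_ι_f_zero]
          exact (P.map_comp _ _).symm.trans ((congrArg P.map comm).trans (P.map_comp _ _))) F' k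
      have h₂ := mapHomologyIsoOfComp_naturality e φ k
      have h₃ := (injectiveResolution Z).isoRightDerivedObj_inv_naturality f
        (injectiveResolution W) φ comm F k
      have h₄ : Q.map ((injectiveResolution Z).isoRightDerivedObj F k).inv ≫
            Q.map ((F.rightDerived k).map f) =
          Q.map (HomologicalComplex.homologyMap ((F.mapHomologicalComplex _).map φ) k) ≫
            Q.map ((injectiveResolution W).isoRightDerivedObj F k).inv :=
        (Q.map_comp _ _).symm.trans ((congrArg Q.map h₃).trans (Q.map_comp _ _))
      exact ((CommSq.mk h₁.symm).horiz_comp ((CommSq.mk h₂.symm).horiz_comp (CommSq.mk h₄))).w.symm)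

/-- Applied termwise to a resolution of `Z`, `α` is already a chain map lifting `α.app Z`, so no
lift has to be chosen. With `α` and `β` induced by an arrow of the index category, this yields
naturality along the diagram. -/
theorem rightDerivedIsoOfComp_natTrans {P₁ P₂ : C ⥤ C'} {F : C ⥤ B} {F' : C' ⥤ B'}
    {Q₁ Q₂ : B ⥤ B'} [P₁.Additive] [PreservesFiniteLimits P₁] [PreservesFiniteColimits P₁]
    [P₁.PreservesInjectiveObjects] [P₂.Additive] [PreservesFiniteLimits P₂]
    [PreservesFiniteColimits P₂] [P₂.PreservesInjectiveObjects] [F.Additive] [F'.Additive]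
    [Q₁.Additive] [PreservesFiniteLimits Q₁] [PreservesFiniteColimits Q₁]
    [Q₂.Additive] [PreservesFiniteLimits Q₂] [PreservesFiniteColimits Q₂]
    (e₁ : P₁ ⋙ F' ≅ F ⋙ Q₁) (e₂ : P₂ ⋙ F' ≅ F ⋙ Q₂) (α : P₁ ⟶ P₂) (β : Q₁ ⟶ Q₂)
    (h : Functor.whiskerRight α F' ≫ e₂.hom = e₁.hom ≫ Functor.whiskerLeft F β) (k : ℕ) (Z : C) :
    (F'.rightDerived k).map (α.app Z) ≫ (rightDerivedIsoOfComp e₂ k).hom.app Z =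
      (rightDerivedIsoOfComp e₁ k).hom.app Z ≫ β.app ((F.rightDerived k).obj Z) := by
  have h₁ := ((injectiveResolution Z).map P₁).isoRightDerivedObj_hom_naturality (α.app Z)
    ((injectiveResolution Z).map P₂)
    ((NatTrans.mapHomologicalComplex α _).app (injectiveResolution Z).cocomplex) (by
      rw [InjectiveResolution.map_ι_f_zero, InjectiveResolution.map_ι_f_zero]
      exact α.naturality _) F' k
  have h₂ := mapHomologyIsoOfComp_natTrans e₁ e₂ α β h (injectiveResolution Z).cocomplex k
  have h₃ := β.naturality ((injectiveResolution Z).isoRightDerivedObj F k).inv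
  exact ((CommSq.mk h₁.symm).horiz_comp ((CommSq.mk h₂.symm).horiz_comp (CommSq.mk h₃))).w.symm

end

/-- Post-composition with the right derived functors of `F` gives the right derived functors of
post-composition with `F`. -/
def whiskeringRightRightDerivedIso {K : Type*} [Category* K] [∀ a b : K, Finite (a ⟶ b)]
    [HasInjectiveResolutions C] [HasInjectiveResolutions (K ⥤ C)] (F : C ⥤ B) [F.Additive]
    [((Functor.whiskeringRight K C B).obj F).Additive] (k : ℕ) :
    (Functor.whiskeringRight K C B).obj (F.rightDerived k) ≅
      ((Functor.whiskeringRight K C B).obj F).rightDerived k :=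
  have (n : K) := preservesInjectiveObjects_evaluation (A := C) n
  let e (n : K) : (evaluation K C).obj n ⋙ F ≅
    (Functor.whiskeringRight K C B).obj F ⋙ (evaluation K B).obj n := Iso.refl _
  NatIso.ofComponents (fun D => NatIso.ofComponents
      (fun n => (rightDerivedIsoOfComp (e n) k).app D)
      (fun {m n} g => rightDerivedIsoOfComp_natTrans (e m) (e n) ((evaluation K C).map g)
        ((evaluation K B).map g)
        -- Both comparison isomorphisms are identities, so the compatibility square is trivial.
        (by ext; exact (Category.comp_id _).trans (Category.id_comp _).symm) k D))
    (fun {D D'} f => by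
      ext n
      exact (rightDerivedIsoOfComp (e n) k).hom.naturality f)

end RightDerived

end CategoryTheory

/-! ### Application to sheaf cohomology. -/

namespace PersistentSheaf

variable (R : Type u) [CommRing R] (X : TopCat.{u})

instance : (corrE R X).Additive where
  map_add := by intros; ext n : 3; rfl

instance : (corrC R X).Additive :=
  have : (corrEquivalence R X).symm.functor.Additive := inferInstanceAs (corrE R X).Additive
  (corrEquivalence R X).symm.inverse_additive

instance : (eta R).Additive :=
  have : (etaEquivalence R).symm.functor.Additive := inferInstanceAs (epsilon R).Additive
  (etaEquivalence R).symm.inverse_additive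

/-- Transported from sheaves of graded modules, which form a Grothendieck abelian category. -/
instance : EnoughInjectives (ℕ ⥤ Shv X (ModuleCat.{u} R)) :=
  EnoughInjectives.of_equivalence (corrC R X)

/-- Global sections commute with `𝒞` and `η`. -/
def corrCGlobalSectionsIso : corrC R X ⋙ globalSections X (GrMod R) ≅
    levelwise (globalSections X (ModuleCat.{u} R)) ⋙ eta R :=
  -- By construction `corrC` applies `eta` to the sections over each open set, in particular over
  -- `⊤`.
  Iso.refl _

/-- Sheaf cohomology commutes with `𝒞` and `η`. -/
def corrCSheafCohomologyIso (k : ℕ) :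
    levelwise (sheafCohomology X (ModuleCat.{u} R) k) ⋙ eta R ≅
      corrC R X ⋙ sheafCohomology X (GrMod R) k :=
  Functor.isoWhiskerRight (whiskeringRightRightDerivedIso _ k) _ ≪≫
    (rightDerivedIsoOfComp (corrCGlobalSectionsIso R X) k).symm

end PersistentSheaf

end

open PersistentSheaf
theorem theorem133 (R : Type u) [CommRing R] (X : TopCat.{u}) (k : ℕ) :
    Nonempty (corrE R X ⋙ levelwise (sheafCohomology X (ModuleCat.{u} R) k) ≅
      sheafCohomology X (GrMod R) k ⋙ epsilon R) ∧
    Nonempty (levelwise (sheafCohomology X (ModuleCat.{u} R) k) ⋙ PersistentSheaf.eta R ≅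
      corrC R X ⋙ sheafCohomology X (GrMod R) k) ∧
    Nonempty (levelwise (sheafCohomology X (ModuleCat.{u} R) k) ≅
      corrC R X ⋙ sheafCohomology X (GrMod R) k ⋙ epsilon R) := by
  let α := corrCSheafCohomologyIso R X k
  -- Apply `epsilon` to `α` and cancel `epsilon` against `eta`.
  let β : levelwise (sheafCohomology X (ModuleCat.{u} R) k) ≅
      corrC R X ⋙ sheafCohomology X (GrMod R) k ⋙ epsilon R :=
    Functor.isoWhiskerLeft (levelwise (sheafCohomology X (ModuleCat.{u} R) k)) (epsilonEtaIso R) ≪≫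
      Functor.isoWhiskerRight α (epsilon R)
  -- For the first claim, precompose `β` with `corrE` and cancel `corrC` against `corrE`.
  exact ⟨⟨Functor.isoWhiskerLeft (corrE R X) β ≪≫
    Functor.isoWhiskerRight (corrECIso R X) (sheafCohomology X (GrMod R) k ⋙ epsilon R)⟩, ⟨α⟩, ⟨β⟩⟩
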